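/- Let $\mathbb{D}=\{z\in\mathbb{C}:|z|<1\}$, let $\mathcal{A}$ be the class of functions analytic in $\mathbb{D}$ of the form $f(z)=z+a_2z^2+a_3z^3+\cdots$, and let $\mathcal{U}$ be the class of those $f\in\mathcal{A}$ with $f(z)\neq 0$ for $z\in\mathbb{D}\setminus\{0\}$ and $$\left|\left(\frac{z}{f(z)}\right)^2f'(z)-1\right|<1\qquad(z\in\mathbb{D}),$$ where $z/f(z)$ is taken to be $1$ at $z=0$. Then every $f\in\mathcal{U}$ satisfies (i) $|a_4-a_2^3|\le 4$; (ii) $|a_5-a_2^4|\le 11$. That is, Krushkal's inequality $|a_n^p-a_2^{p(n-1)}|\le 2^{p(n-1)}-n^p$ holds for every $f\in\mathcal{U}$ when $p=1$ and $n=4$ or $n=5$. Both inequalities are sharp: the Koebe function $k(z)=\dfrac{z}{(1-z)^2}$ and all its rotations $z\mapsto e^{-i\theta}k(e^{i\theta}z)$, $\theta\in\mathbb{R}$, belong to $\mathcal{U}$, and equality holds in both (i) and (ii) for each of them. -/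

import Mathlib

/-- The class `𝒜`: functions analytic in the open unit disc of the form `z + a₂ z² + a₃ z³ + ⋯`.
(Values outside the open unit disc play no role.) -/
def classA : Set (ℂ → ℂ) :=
  {f | AnalyticOnNhd ℂ f (Metric.ball 0 1) ∧ f 0 = 0 ∧ deriv f 0 = 1}

/-- The class `𝒰`: functions `f ∈ 𝒜` with `|(z / f z)² f'(z) - 1| < 1` in the open unit disc.
The quotient `z / f z` has the value `1` at the removable singularity `z = 0`, where the inequality
reads `0 < 1`; so the condition is imposed at the points `z ≠ 0`, and there the quotient has
to be defined, i.e. `f z ≠ 0`. -/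
def classU : Set (ℂ → ℂ) :=
  {f | f ∈ classA ∧ ∀ z ∈ Metric.ball (0 : ℂ) 1, z ≠ 0 →
    f z ≠ 0 ∧ ‖(z / f z) ^ 2 * deriv f z - 1‖ < 1}

/-- The coefficient `aₙ` in the Taylor expansion `f z = ∑ aₙ zⁿ` at the origin. -/
noncomputable def taylorCoeff (f : ℂ → ℂ) (n : ℕ) : ℂ :=
  iteratedDeriv n f 0 / (n.factorial : ℂ)

/-- Krushkal's inequality `|aₙ ^ p - a₂ ^ (p (n - 1))| ≤ 2 ^ (p (n - 1)) - n ^ p`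
(for `n ≥ 1`). -/
def KrushkalInequality (f : ℂ → ℂ) (n p : ℕ) : Prop :=
  ‖taylorCoeff f n ^ p - taylorCoeff f 2 ^ (p * (n - 1))‖ ≤ (2 : ℝ) ^ (p * (n - 1)) - (n : ℝ) ^ p

/-- The Koebe function `k z = z / (1 - z)²`. -/
noncomputable def koebe (z : ℂ) : ℂ := z / (1 - z) ^ 2

/-- The rotation `z ↦ e^{-iθ} f (e^{iθ} z)` of `f`; for `θ = 0` it is `f` itself. -/
noncomputable def rotateFun (θ : ℝ) (f : ℂ → ℂ) (z : ℂ) : ℂ :=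
  Complex.exp (-(θ * Complex.I)) * f (Complex.exp (θ * Complex.I) * z)

open Filter Topology

/-! Everything passes to `p = z / f`, for which `(z / f)² f' = p - z p'`. Hence `u = p - z p' - 1`
is bounded by 1, and its `n`-th coefficient is `-(n - 1)` times that of `p`, for `n ≥ 1`. Put `a =
a₂` and let `-c₁, -c₂, -c₃` be the coefficients of `p` at `z², z³, z⁴`. Then `a₄ - a₂³ = 2 a c₁ +
c₂` and `a₅ - a₂⁴ = c₁ (a₃ + 2 a²) + 2 a c₂ + c₃`.

Two sources of bounds suffice. A positive kernel (`norm_taylorCoeff_add_half_norm_le`), applied to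
`u`, gives `|c₁| + |c₂| ≤ 1` and `|c₁| + 3/2 |c₃| ≤ 1`. Jack's lemma gives `p = (1 + w)²` with `w 0
= 0` and `|w| ≤ 1` (`exists_sq_one_add_eq`); the kernel bound for `w` then yields `|a₂| ≤ 2` and,
with `|c₁| ≤ 1`, `|a₃| ≤ 3`. The triangle inequality finishes. -/

/-! ### Calculus of Taylor coefficients. -/

theorem taylorCoeff_congr {f g : ℂ → ℂ} (h : f =ᶠ[𝓝 0] g) (n : ℕ) :
    taylorCoeff f n = taylorCoeff g n := by
  rw [taylorCoeff, taylorCoeff, h.iteratedDeriv_eq]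

theorem taylorCoeff_mul {f g : ℂ → ℂ} (hf : AnalyticAt ℂ f 0) (hg : AnalyticAt ℂ g 0) (n : ℕ) :
    taylorCoeff (fun z => f z * g z) n =
      ∑ i ∈ Finset.range (n + 1), taylorCoeff f i * taylorCoeff g (n - i) := by
  rw [taylorCoeff, iteratedDeriv_fun_mul hf.contDiffAt hg.contDiffAt, Finset.sum_div]
  refine Finset.sum_congr rfl fun i hi => ?_
  have hin : i ≤ n := Nat.lt_succ_iff.mp (Finset.mem_range.mp hi)
  have h := Nat.choose_mul_factorial_mul_factorial hin
  have h' : ((n.choose i : ℕ) : ℂ) * (i.factorial : ℂ) * ((n - i).factorial : ℂ)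
      = (n.factorial : ℂ) := by exact_mod_cast h
  have h1 : (i.factorial : ℂ) ≠ 0 := by exact_mod_cast i.factorial_ne_zero
  have h2 : ((n - i).factorial : ℂ) ≠ 0 := by exact_mod_cast (n - i).factorial_ne_zero
  have h3 : (n.factorial : ℂ) ≠ 0 := by exact_mod_cast n.factorial_ne_zero
  rw [taylorCoeff, taylorCoeff, div_mul_div_comm, div_eq_div_iff h3 (mul_ne_zero h1 h2), ← h']
  ring

theorem taylorCoeff_deriv (f : ℂ → ℂ) (n : ℕ) :
    taylorCoeff (deriv f) n = (n + 1) * taylorCoeff f (n + 1) := by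
  have h3 : (n.factorial : ℂ) ≠ 0 := by exact_mod_cast n.factorial_ne_zero
  have h4 : (n : ℂ) + 1 ≠ 0 := by exact_mod_cast n.succ_ne_zero
  rw [taylorCoeff, taylorCoeff, iteratedDeriv_succ', Nat.factorial_succ]
  push_cast
  field_simp

theorem taylorCoeff_sub {f g : ℂ → ℂ} (hf : AnalyticAt ℂ f 0) (hg : AnalyticAt ℂ g 0) (n : ℕ) :
    taylorCoeff (fun z => f z - g z) n = taylorCoeff f n - taylorCoeff g n := by
  rw [taylorCoeff, iteratedDeriv_fun_sub hf.contDiffAt hg.contDiffAt, sub_div]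
  rfl

theorem taylorCoeff_zero (f : ℂ → ℂ) : taylorCoeff f 0 = f 0 := by
  simp [taylorCoeff]

theorem taylorCoeff_one (f : ℂ → ℂ) : taylorCoeff f 1 = deriv f 0 := by
  simp [taylorCoeff]

theorem taylorCoeff_const (c : ℂ) (n : ℕ) :
    taylorCoeff (fun _ => c) n = if n = 0 then c else 0 := by
  rw [taylorCoeff, iteratedDeriv_const]
  split_ifs with h <;> simp [h]

theorem taylorCoeff_id (n : ℕ) :
    taylorCoeff (fun z => z) n = if n = 1 then 1 else 0 := by
  rcases n with _ | n
  · simp [taylorCoeff_zero]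
  · have h := taylorCoeff_deriv (fun z => z) n
    have h4 : (n : ℂ) + 1 ≠ 0 := by exact_mod_cast n.succ_ne_zero
    have hd : deriv (fun z : ℂ => z) = fun _ => 1 := by ext; simp
    rw [hd, taylorCoeff_const] at h
    rcases n with _ | n
    · simpa using h.symm
    · have h5 : (n : ℂ) + 1 + 1 ≠ 0 := by exact_mod_cast (n + 1).succ_ne_zero
      simpa [h5, eq_comm] using h

/-! ### Coefficient inequalities for functions bounded by 1. -/

open Complex in
theorem integral_circleMap_mul_exp {u : ℂ → ℂ} (hu : DifferentiableOn ℂ u (Metric.ball 0 1))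
    {r : ℝ} (hr : 0 < r) (hr1 : r < 1) (k : ℕ) :
    ∫ θ in (0 : ℝ)..2 * Real.pi, u (circleMap 0 r θ) * exp (-(k * θ * I)) =
      2 * Real.pi * (r ^ k * taylorCoeff u k) := by
  have h := DifferentiableOn.circleIntegral_one_div_sub_center_pow_smul hr k
    (hu.mono (Metric.closedBall_subset_ball hr1))
  rw [circleIntegral] at h
  have hrc : (r : ℂ) ≠ 0 := by exact_mod_cast hr.ne'
  have key : ∀ θ : ℝ, deriv (circleMap 0 r) θ •
      ((1 / (circleMap 0 r θ - 0) ^ (k + 1)) • u (circleMap 0 r θ)) =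
      (I / r ^ k) * (u (circleMap 0 r θ) * exp (-(k * θ * I))) := by
    intro θ
    have he : exp (-(k * θ * I)) = (exp (θ * I) ^ k)⁻¹ := by
      rw [← Complex.exp_nat_mul, ← Complex.exp_neg]; ring_nf
    have hne := Complex.exp_ne_zero (θ * I)
    rw [he]
    simp only [deriv_circleMap, circleMap, smul_eq_mul, zero_add, sub_zero]
    field_simp
    ring
  simp only [key] at h
  rw [intervalIntegral.integral_const_mul] at h
  have hI := I_ne_zero
  rw [div_mul_eq_mul_div, div_eq_iff (pow_ne_zero k hrc)] at h
  apply mul_left_cancel₀ hI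
  rw [h, taylorCoeff, smul_eq_mul]
  ring

theorem exists_norm_add_mul_eq (a b : ℂ) : ∃ ε : ℂ, ‖ε‖ = 1 ∧ ‖a + ε * b‖ = ‖a‖ + ‖b‖ := by
  refine ⟨Complex.exp ((a.arg - b.arg : ℝ) * Complex.I), Complex.norm_exp_ofReal_mul_I _, ?_⟩
  have h : a + Complex.exp ((a.arg - b.arg : ℝ) * Complex.I) * b =
      ((‖a‖ + ‖b‖ : ℝ) : ℂ) * Complex.exp (a.arg * Complex.I) := by
    have hab : Complex.exp ((a.arg - b.arg : ℝ) * Complex.I) * Complex.exp (b.arg * Complex.I) =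
        Complex.exp (a.arg * Complex.I) := by
      rw [← Complex.exp_add]; push_cast; ring_nf
    push_cast at hab ⊢
    linear_combination -Complex.norm_mul_exp_arg_mul_I a -
      Complex.exp ((a.arg - b.arg) * Complex.I) * Complex.norm_mul_exp_arg_mul_I b + ‖b‖ * hab
  rw [h, norm_mul, Complex.norm_exp_ofReal_mul_I, mul_one, Complex.norm_real, Real.norm_eq_abs,
    abs_of_nonneg (by positivity)]

-- On the circle of radius `r`, integrate `u e^{-imθ}` against the nonnegative kernel `1 + Re (ε
-- e^{-inθ})`, of total mass `2π`. The kernel picks out the coefficients `m`, `m + n` and `m - n`,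
-- and the last one vanishes by `h0`.
open Complex in
theorem norm_taylorCoeff_add_mul_le {u : ℂ → ℂ} (hu : DifferentiableOn ℂ u (Metric.ball 0 1))
    (hb : ∀ z ∈ Metric.ball (0 : ℂ) 1, ‖u z‖ ≤ 1) {m n : ℕ} (hn : 0 < n) (hnm : n ≤ m)
    (h0 : taylorCoeff u (m - n) = 0) {r : ℝ} (hr : 0 < r) (hr1 : r < 1) {ε : ℂ} (hε : ‖ε‖ = 1) :
    ‖r ^ m * taylorCoeff u m + ε * (r ^ (m + n) * taylorCoeff u (m + n) / 2)‖ ≤ 1 := by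
  have hmem : ∀ θ : ℝ, circleMap 0 r θ ∈ Metric.ball (0 : ℂ) 1 := fun θ => by
    simp [abs_of_pos hr, hr1]
  have huc : Continuous fun θ : ℝ => u (circleMap 0 r θ) :=
    hu.continuousOn.comp_continuous (continuous_circleMap 0 r) hmem
  have hi : ∀ k : ℕ, IntervalIntegrable
      (fun θ : ℝ => u (circleMap 0 r θ) * exp (-(k * θ * I))) MeasureTheory.volume 0
        (2 * Real.pi) := fun k => by
    exact (huc.mul (by fun_prop)).intervalIntegrable _ _
  set K : ℝ → ℝ := fun θ => 1 + (ε * exp (-(n * θ * I))).re with hK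
  have hKc : Continuous K := by fun_prop
  have hKnorm : ∀ θ : ℝ, ‖exp (-(n * θ * I))‖ = 1 := fun θ => by
    have : -((n : ℂ) * θ * I) = ((-(n * θ) : ℝ) : ℂ) * I := by push_cast; ring
    rw [this, norm_exp_ofReal_mul_I]
  have hK0 : ∀ θ, 0 ≤ K θ := fun θ => by
    have h1 := abs_re_le_norm (ε * exp (-(n * θ * I)))
    rw [norm_mul, hε, hKnorm, one_mul] at h1
    have := neg_abs_le (ε * exp (-(n * θ * I))).re
    simp only [hK]
    linarith
  have hconj : ∀ θ : ℝ, (starRingEnd ℂ) (exp (-(n * θ * I))) = exp (n * θ * I) := fun θ => by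
    rw [← exp_conj]; simp
  have hKint : ∫ θ in (0 : ℝ)..2 * Real.pi, K θ = 2 * Real.pi := by
    -- The oscillating part of the kernel integrates to zero: it involves the `n`-th coefficient of
    -- a constant, with `n > 0`.
    have h1 := integral_circleMap_mul_exp (u := fun _ => ε) (differentiableOn_const _) hr hr1 n
    rw [taylorCoeff_const, if_neg hn.ne', mul_zero, mul_zero] at h1
    have hci : IntervalIntegrable (fun θ : ℝ => ε * exp (-(n * θ * I))) MeasureTheory.volume 0
        (2 * Real.pi) := by
      apply Continuous.intervalIntegrable
      fun_prop
    have h2 := reCLM.intervalIntegral_comp_comm hci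
    rw [h1] at h2
    have h3 : ∫ θ in (0 : ℝ)..2 * Real.pi, (ε * exp (-(n * θ * I))).re = 0 := by simpa using h2
    rw [hK, intervalIntegral.integral_add (by simp)
      (Continuous.intervalIntegrable (by fun_prop) _ _), h3]
    simp
  have hform : ∀ θ : ℝ, u (circleMap 0 r θ) * exp (-(m * θ * I)) * (K θ : ℂ) =
      u (circleMap 0 r θ) * exp (-(m * θ * I)) +
      (ε / 2 * (u (circleMap 0 r θ) * exp (-((m + n : ℕ) * θ * I))) +
      (starRingEnd ℂ) ε / 2 * (u (circleMap 0 r θ) * exp (-((m - n : ℕ) * θ * I)))) := fun θ => by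
    have h1 : exp (-((m + n : ℕ) * θ * I)) = exp (-(m * θ * I)) * exp (-(n * θ * I)) := by
      rw [← exp_add]; push_cast; ring_nf
    have h2 : exp (-((m - n : ℕ) * θ * I)) = exp (-(m * θ * I)) * exp (n * θ * I) := by
      rw [← exp_add, Nat.cast_sub hnm]; ring_nf
    have h3 : (K θ : ℂ) = 1 + (ε * exp (-(n * θ * I)) + (starRingEnd ℂ) ε * exp (n * θ * I)) / 2 := by
      simp only [hK]
      push_cast
      rw [re_eq_add_conj, map_mul, hconj]
    rw [h1, h2, h3]
    ring
  have hint : ∫ θ in (0 : ℝ)..2 * Real.pi, u (circleMap 0 r θ) * exp (-(m * θ * I)) * (K θ : ℂ) =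
      2 * Real.pi * (r ^ m * taylorCoeff u m + ε * (r ^ (m + n) * taylorCoeff u (m + n) / 2)) := by
    simp only [hform]
    rw [intervalIntegral.integral_add (hi m) (((hi _).const_mul _).add ((hi _).const_mul _)),
      intervalIntegral.integral_add ((hi _).const_mul _) ((hi _).const_mul _),
      intervalIntegral.integral_const_mul, intervalIntegral.integral_const_mul,
      integral_circleMap_mul_exp hu hr hr1, integral_circleMap_mul_exp hu hr hr1,
      integral_circleMap_mul_exp hu hr hr1, h0]
    ring
  have hle : ‖∫ θ in (0 : ℝ)..2 * Real.pi,
      u (circleMap 0 r θ) * exp (-(m * θ * I)) * (K θ : ℂ)‖ ≤ ∫ θ in (0 : ℝ)..2 * Real.pi, K θ := by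
    refine intervalIntegral.norm_integral_le_of_norm_le (by positivity) (MeasureTheory.ae_of_all _ fun θ _ => ?_)
      (hKc.intervalIntegrable _ _)
    have h1 : ‖exp (-(m * θ * I))‖ = 1 := by
      have : -((m : ℂ) * θ * I) = ((-(m * θ) : ℝ) : ℂ) * I := by push_cast; ring
      rw [this, norm_exp_ofReal_mul_I]
    rw [norm_mul, norm_mul, h1, mul_one, norm_real, Real.norm_eq_abs, abs_of_nonneg (hK0 θ)]
    exact mul_le_of_le_one_left (hK0 θ) (hb _ (hmem θ))
  rw [hint, hKint, norm_mul] at hle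
  have hpi : ‖(2 * Real.pi : ℂ)‖ = 2 * Real.pi := by
    rw [norm_mul, norm_real, Real.norm_eq_abs, abs_of_pos Real.pi_pos]; simp
  rw [hpi] at hle
  exact le_of_mul_le_mul_left (by simpa using hle) Real.two_pi_pos

/-- Choose `ε` to align the phases of the two terms, then let `r → 1`. -/
theorem norm_taylorCoeff_add_half_norm_le {u : ℂ → ℂ}
    (hu : DifferentiableOn ℂ u (Metric.ball 0 1))
    (hb : ∀ z ∈ Metric.ball (0 : ℂ) 1, ‖u z‖ ≤ 1) {m n : ℕ} (hn : 0 < n) (hnm : n ≤ m)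
    (h0 : taylorCoeff u (m - n) = 0) :
    ‖taylorCoeff u m‖ + ‖taylorCoeff u (m + n)‖ / 2 ≤ 1 := by
  have hr : ∀ r ∈ Set.Ioo (0 : ℝ) 1,
      r ^ m * ‖taylorCoeff u m‖ + r ^ (m + n) * ‖taylorCoeff u (m + n)‖ / 2 ≤ 1 := by
    rintro r ⟨hr, hr1⟩
    obtain ⟨ε, hε, h⟩ := exists_norm_add_mul_eq ((r : ℂ) ^ m * taylorCoeff u m)
      ((r : ℂ) ^ (m + n) * taylorCoeff u (m + n) / 2)
    have h1 := norm_taylorCoeff_add_mul_le hu hb hn hnm h0 hr hr1 hε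
    rw [h] at h1
    simpa [abs_of_pos hr] using h1
  have hc : Continuous fun r : ℝ =>
      r ^ m * ‖taylorCoeff u m‖ + r ^ (m + n) * ‖taylorCoeff u (m + n)‖ / 2 := by fun_prop
  have ht := (hc.tendsto 1).mono_left (nhdsWithin_le_nhds (s := Set.Iio 1))
  simp only [one_pow, one_mul] at ht
  refine le_of_tendsto ht ?_
  filter_upwards [Ioo_mem_nhdsLT (zero_lt_one (α := ℝ))] with r h using hr r h

/-! ### Square roots, Jack's lemma and the representation `p = (1 + w)²`. -/

/-- The root is `exp L` with `L' = p' / (2 p)` and `L 0 = 0`; `p e^{-2L}` has zero derivative. -/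
theorem exists_sq_eq_of_ne_zero {p : ℂ → ℂ} (hp : DifferentiableOn ℂ p (Metric.ball 0 1))
    (hp0 : ∀ z ∈ Metric.ball (0 : ℂ) 1, p z ≠ 0) (h1 : p 0 = 1) :
    ∃ s : ℂ → ℂ, DifferentiableOn ℂ s (Metric.ball 0 1) ∧ s 0 = 1 ∧
      ∀ z ∈ Metric.ball (0 : ℂ) 1, s z ^ 2 = p z := by
  have hd : DifferentiableOn ℂ (fun z => deriv p z / (2 * p z)) (Metric.ball 0 1) :=
    (hp.deriv Metric.isOpen_ball).div (hp.const_mul 2) fun z hz => mul_ne_zero two_ne_zero (hp0 z hz)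
  obtain ⟨L, hL0, hL⟩ := hd.isExactOn_ball.with_val_at 0 0
  refine ⟨fun z => Complex.exp (L z),
    fun z hz => (hL z hz).differentiableAt.cexp.differentiableWithinAt, by simp [hL0], ?_⟩
  have hder : ∀ z ∈ Metric.ball (0 : ℂ) 1,
      HasDerivAt (fun z => p z * Complex.exp (-(2 * L z))) 0 z := fun z hz => by
    have hpz := (hp.differentiableAt (Metric.isOpen_ball.mem_nhds hz)).hasDerivAt
    refine (hpz.fun_mul ((hL z hz).const_mul 2).fun_neg.cexp).congr_deriv ?_
    have h2 : p z * (2 * (deriv p z / (2 * p z))) = deriv p z := by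
      have := hp0 z hz
      field_simp
    linear_combination -Complex.exp (-(2 * L z)) * h2
  intro z hz
  have hconst := Metric.isOpen_ball.is_const_of_deriv_eq_zero
    (convex_ball (0 : ℂ) 1).isPreconnected
    (fun z hz => (hder z hz).differentiableAt.differentiableWithinAt)
    (fun z hz => (hder z hz).deriv) hz (Metric.mem_ball_self one_pos)
  simp only [hL0, h1, mul_zero, neg_zero, Complex.exp_zero, mul_one] at hconst
  rw [Complex.exp_neg, mul_inv_eq_one₀ (Complex.exp_ne_zero _)] at hconst
  rw [hconst, ← Complex.exp_nat_mul]
  norm_num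

/-- A point of smallest modulus where `w` leaves the open unit disc. -/
theorem exists_first_norm_eq_one {w : ℂ → ℂ} (hw : DifferentiableOn ℂ w (Metric.ball 0 1))
    (hw0 : w 0 = 0) {z₁ : ℂ} (hz₁ : z₁ ∈ Metric.ball (0 : ℂ) 1) (h : 1 ≤ ‖w z₁‖) :
    ∃ z₀ ∈ Metric.ball (0 : ℂ) 1, z₀ ≠ 0 ∧ ‖w z₀‖ = 1 ∧
      (∀ z ∈ Metric.closedBall (0 : ℂ) ‖z₀‖, ‖w z‖ ≤ 1) := by
  have hz₁' : ‖z₁‖ < 1 := by simpa using hz₁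
  have hsub : Metric.closedBall (0 : ℂ) ‖z₁‖ ⊆ Metric.ball 0 1 :=
    Metric.closedBall_subset_ball hz₁'
  have hcl : IsClosed (Metric.closedBall (0 : ℂ) ‖z₁‖ ∩ (fun z => ‖w z‖) ⁻¹' Set.Ici 1) :=
    (hw.continuousOn.mono hsub).norm.preimage_isClosed_of_isClosed Metric.isClosed_closedBall
      isClosed_Ici
  have hcpt := (isCompact_closedBall (0 : ℂ) ‖z₁‖).of_isClosed_subset hcl Set.inter_subset_left
  obtain ⟨z₀, ⟨hz₀, hz₀'⟩, hmin⟩ := hcpt.exists_isMinOn ⟨z₁, by simp, h⟩ continuous_norm.continuousOn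
  have hz₀1 : z₀ ∈ Metric.ball (0 : ℂ) 1 := hsub hz₀
  have hz₀n : ‖z₀‖ ≤ ‖z₁‖ := by simpa using hz₀
  have hne : z₀ ≠ 0 := by
    rintro rfl
    simp only [Set.mem_preimage, hw0, norm_zero, Set.mem_Ici] at hz₀'
    linarith
  have hlt : ∀ z ∈ Metric.ball (0 : ℂ) ‖z₀‖, ‖w z‖ ≤ 1 := fun z hz => by
    by_contra! hcon
    have hz' : ‖z‖ < ‖z₀‖ := by simpa using hz
    have := hmin (a := z) ⟨by simpa using hz'.le.trans hz₀n, hcon.le⟩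
    exact absurd hz' (not_lt.mpr this)
  have hle : ∀ z ∈ Metric.closedBall (0 : ℂ) ‖z₀‖, ‖w z‖ ≤ 1 := fun z hz => by
    rw [← closure_ball (0 : ℂ) (norm_ne_zero_iff.mpr hne)] at hz
    refine ContinuousWithinAt.closure_le hz (f := fun z => ‖w z‖) ?_ continuousWithinAt_const hlt
    rw [closure_ball (0 : ℂ) (norm_ne_zero_iff.mpr hne)] at hz
    have hz1 : z ∈ Metric.ball (0 : ℂ) 1 := hsub (Metric.closedBall_subset_closedBall hz₀n hz)
    exact (hw.differentiableAt (Metric.isOpen_ball.mem_nhds hz1)).continuousAt.norm.continuousWithinAt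
  exact ⟨z₀, hz₀1, hne, le_antisymm (hle z₀ (by simp)) hz₀', hle⟩

/-- **Jack's lemma**. -/
theorem exists_mul_deriv_eq_of_norm_le {w : ℂ → ℂ} {z₀ : ℂ} (hz₀ : z₀ ≠ 0)
    (hw : DifferentiableOn ℂ w (Metric.ball 0 ‖z₀‖)) (hwz : DifferentiableAt ℂ w z₀)
    (hw0 : w 0 = 0) (h1 : ‖w z₀‖ = 1) (hle : ∀ z ∈ Metric.closedBall (0 : ℂ) ‖z₀‖, ‖w z‖ ≤ 1) :
    ∃ m : ℝ, 1 ≤ m ∧ z₀ * deriv w z₀ = m * w z₀ := by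
  set q : ℂ := (starRingEnd ℂ) (w z₀) * (z₀ * deriv w z₀) with hq
  have hr : 0 < ‖z₀‖ := norm_pos_iff.mpr hz₀
  -- Along the circle through `z₀`, `‖w‖²` is maximal at `z₀`, so its tangential derivative
  -- vanishes.
  have him : q.im = 0 := by
    have hc : HasDerivAt (fun θ : ℝ => z₀ * Complex.exp (θ * Complex.I)) (z₀ * Complex.I) 0 := by
      have := ((Complex.ofRealCLM.hasDerivAt (x := 0)).mul_const Complex.I).cexp.const_mul z₀
      simpa using this
    have hwz' : HasDerivAt w (deriv w z₀) (z₀ * Complex.exp ((0 : ℝ) * Complex.I)) := by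
      simpa using hwz.hasDerivAt
    have hd := (hwz'.comp (0 : ℝ) hc).norm_sq
    have hmax : IsLocalMax (fun θ : ℝ => ‖(w ∘ fun θ : ℝ => z₀ * Complex.exp (θ * Complex.I)) θ‖ ^ 2) 0 := by
      refine Eventually.of_forall fun θ => ?_
      have := hle (z₀ * Complex.exp (θ * Complex.I))
        (by simp [Complex.norm_exp_ofReal_mul_I])
      simpa [h1] using this
    have := hmax.hasDerivAt_eq_zero hd
    simp only [Function.comp, Complex.ofReal_zero, zero_mul, Complex.exp_zero, mul_one,
      Complex.inner] at this
    have h2 : deriv w z₀ * (z₀ * Complex.I) * (starRingEnd ℂ) (w z₀) = q * Complex.I := by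
      rw [hq]; ring
    rw [h2, Complex.mul_I_re] at this
    linarith
  -- By the Schwarz lemma `‖w (t z₀)‖² - t² ≤ 0` for `0 < t < 1`, with equality at `t = 1`; hence
  -- the derivative `2 Re q - 2` there is nonnegative.
  have hre : 1 ≤ q.re := by
    have hc : HasDerivAt (fun t : ℝ => z₀ * (t : ℂ)) z₀ 1 := by
      simpa using (Complex.ofRealCLM.hasDerivAt (x := 1)).const_mul z₀
    have hwz' : HasDerivAt w (deriv w z₀) (z₀ * ((1 : ℝ) : ℂ)) := by
      simpa using hwz.hasDerivAt
    have hd := ((hwz'.comp (1 : ℝ) hc).norm_sq).sub ((hasDerivAt_id (1 : ℝ)).pow 2)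
    have hnonneg := ge_of_tendsto (b := 0) (hd.tendsto_slope.mono_left
      (nhdsWithin_mono (1 : ℝ) (s := Set.Iio 1) fun t ht => ne_of_lt ht)) (by
        filter_upwards [Ioo_mem_nhdsLT (zero_lt_one (α := ℝ))] with t ht
        have hmem : z₀ * (t : ℂ) ∈ Metric.ball (0 : ℂ) ‖z₀‖ := by
          simpa [abs_of_pos ht.1] using mul_lt_of_lt_one_right hr ht.2
        have hs := Complex.dist_le_div_mul_dist_of_mapsTo_ball hw (R₂ := 1)
          (fun z hz => by simpa [hw0] using hle z (Metric.ball_subset_closedBall hz)) hmem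
        have hs' : ‖w (z₀ * t)‖ ≤ t := by
          have : 1 / ‖z₀‖ * (‖z₀‖ * t) = t := by field_simp
          simpa [hw0, abs_of_pos ht.1, hr.ne'] using hs
        have hsq : ‖w (z₀ * t)‖ ^ 2 ≤ t ^ 2 := pow_le_pow_left₀ (norm_nonneg _) hs' 2
        rw [slope_def_field]
        apply div_nonneg_of_nonpos
        · simpa [h1] using hsq
        · linarith [ht.2])
    simp only [Function.comp, Complex.ofReal_one, mul_one, Complex.inner] at hnonneg
    have h2 : deriv w z₀ * z₀ * (starRingEnd ℂ) (w z₀) = q := by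
      rw [hq]; ring
    rw [h2] at hnonneg
    norm_num at hnonneg
    linarith
  refine ⟨q.re, hre, ?_⟩
  have hqre : (q.re : ℂ) = q := Complex.ext (by simp) (by simp [him])
  have hww : w z₀ * (starRingEnd ℂ) (w z₀) = 1 := by
    rw [Complex.mul_conj, Complex.normSq_eq_norm_sq, h1]; simp
  rw [hqre, hq]
  linear_combination (-(z₀ * deriv w z₀)) * hww

theorem exists_sq_one_add_eq {p : ℂ → ℂ} (hp : DifferentiableOn ℂ p (Metric.ball 0 1))
    (hp0 : ∀ z ∈ Metric.ball (0 : ℂ) 1, p z ≠ 0) (h1 : p 0 = 1)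
    (hU : ∀ z ∈ Metric.ball (0 : ℂ) 1, ‖p z - z * deriv p z - 1‖ < 1) :
    ∃ w : ℂ → ℂ, DifferentiableOn ℂ w (Metric.ball 0 1) ∧ w 0 = 0 ∧
      (∀ z ∈ Metric.ball (0 : ℂ) 1, ‖w z‖ ≤ 1) ∧
      ∀ z ∈ Metric.ball (0 : ℂ) 1, p z = (1 + w z) * (1 + w z) := by
  obtain ⟨s, hs, hs0, hsp⟩ := exists_sq_eq_of_ne_zero hp hp0 h1
  have hw : DifferentiableOn ℂ (fun z => s z - 1) (Metric.ball 0 1) := hs.sub_const 1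
  refine ⟨fun z => s z - 1, hw, by simp [hs0], ?_, fun z hz => by rw [← hsp z hz]; ring⟩
  by_contra! hcon
  obtain ⟨z₁, hz₁, hgt⟩ := hcon
  obtain ⟨z, hz, hne, hnorm, hle⟩ := exists_first_norm_eq_one hw (by simp [hs0]) hz₁ hgt.le
  have hz' : ‖z‖ < 1 := by simpa using hz
  have hsz := hs.differentiableAt (Metric.isOpen_ball.mem_nhds hz)
  obtain ⟨m, hm, hjack⟩ := exists_mul_deriv_eq_of_norm_le hne
    (hw.mono (Metric.ball_subset_ball hz'.le)) (hsz.sub_const 1) (by simp [hs0]) hnorm hle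
  have hpd : deriv p z = 2 * s z * deriv s z := by
    have he : p =ᶠ[𝓝 z] fun z => s z ^ 2 := by
      filter_upwards [Metric.isOpen_ball.mem_nhds hz] with y hy using (hsp y hy).symm
    rw [he.deriv_eq]
    simpa using (hsz.hasDerivAt.fun_pow 2).deriv
  rw [deriv_sub_const] at hjack
  have hb := hU z hz
  set v := s z - 1 with hv
  have hsv : s z = 1 + v := by rw [hv]; ring
  -- With `z w' = m v` and `|v| = 1`, the modulus is at least `(2m - 1) - (2m - 2) = 1`, contrary to
  -- `hU`.
  have hform : p z - z * deriv p z - 1 = v * ((((2 * m - 1 : ℝ) : ℂ) * -v) - ((2 * m - 2 : ℝ) : ℂ)) := by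
    rw [hpd, ← hsp z hz, hsv]
    push_cast
    linear_combination (-2 * (1 + v)) * hjack
  rw [hform, norm_mul, hnorm, one_mul] at hb
  have h3 := norm_sub_norm_le (((2 * m - 1 : ℝ) : ℂ) * -v) ((2 * m - 2 : ℝ) : ℂ)
  rw [norm_mul, norm_neg, hnorm, Complex.norm_real, Complex.norm_real, Real.norm_eq_abs,
    Real.norm_eq_abs, abs_of_nonneg (by linarith), abs_of_nonneg (by linarith)] at h3
  linarith

/-! ### Coefficients of functions in `𝒰` and the two inequalities. -/

/-- `p` is the reciprocal of `dslope f 0`, which fills in the value of `f z / z` at the origin. -/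
theorem exists_div_of_mem_classU {f : ℂ → ℂ} (hf : f ∈ classU) :
    ∃ p : ℂ → ℂ, DifferentiableOn ℂ p (Metric.ball 0 1) ∧ p 0 = 1 ∧
      (∀ z ∈ Metric.ball (0 : ℂ) 1, p z ≠ 0) ∧
      (∀ z ∈ Metric.ball (0 : ℂ) 1, f z * p z = z) ∧
      ∀ z ∈ Metric.ball (0 : ℂ) 1, ‖p z - z * deriv p z - 1‖ < 1 := by
  obtain ⟨⟨hfa, hf0, hf1⟩, hfU⟩ := hf
  have hfd : DifferentiableOn ℂ f (Metric.ball 0 1) := hfa.differentiableOn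
  set g : ℂ → ℂ := dslope f 0 with hg
  have hgd : DifferentiableOn ℂ g (Metric.ball 0 1) :=
    (Complex.differentiableOn_dslope (Metric.ball_mem_nhds 0 one_pos)).mpr hfd
  have hfg : ∀ z, f z = z * g z := fun z => by
    have := sub_smul_dslope f 0 z
    simpa [hf0] using this.symm
  have hg0 : g 0 = 1 := by rw [hg, dslope_same, hf1]
  have hgne : ∀ z ∈ Metric.ball (0 : ℂ) 1, g z ≠ 0 := fun z hz => by
    rcases eq_or_ne z 0 with rfl | hne
    · simp [hg0]
    · exact right_ne_zero_of_mul (hfg z ▸ (hfU z hz hne).1)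
  refine ⟨fun z => (g z)⁻¹, hgd.inv hgne, by simp [hg0], fun z hz => inv_ne_zero (hgne z hz),
    fun z hz => by rw [hfg, mul_inv_cancel_right₀ (hgne z hz)], fun z hz => ?_⟩
  have hgz := (hgd.differentiableAt (Metric.isOpen_ball.mem_nhds hz)).hasDerivAt
  have hne := hgne z hz
  rcases eq_or_ne z 0 with rfl | hz0
  · simp [hg0]
  have hdf : deriv f z = g z + z * deriv g z := by
    rw [show f = fun z => z * g z from funext hfg]
    simpa using ((hasDerivAt_id' z).fun_mul hgz).deriv
  have hb := (hfU z hz hz0).2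
  rw [(hgz.fun_inv hne).deriv]
  convert hb using 2
  rw [hdf, hfg]
  field_simp
  ring

theorem analyticAt_self {z : ℂ} : AnalyticAt ℂ (fun z => z) z := analyticAt_id

theorem taylorCoeff_mul_eq_id {f p : ℂ → ℂ} (hf : AnalyticAt ℂ f 0) (hp : AnalyticAt ℂ p 0)
    (h : ∀ᶠ z in 𝓝 0, f z * p z = z) (n : ℕ) :
    ∑ i ∈ Finset.range (n + 1), taylorCoeff f i * taylorCoeff p (n - i) =
      if n = 1 then 1 else 0 := by
  rw [← taylorCoeff_mul hf hp, taylorCoeff_congr h, taylorCoeff_id]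

theorem taylorCoeff_sub_mul_deriv {p : ℂ → ℂ} (hp : AnalyticAt ℂ p 0) (n : ℕ) :
    taylorCoeff (fun z => p z - z * deriv p z - 1) (n + 1) = -n * taylorCoeff p (n + 1) := by
  have hm : taylorCoeff (fun z => z * deriv p z) (n + 1) = (n + 1) * taylorCoeff p (n + 1) := by
    rw [taylorCoeff_mul analyticAt_self hp.deriv, Finset.sum_eq_single 1]
    · simp [taylorCoeff_id, taylorCoeff_deriv]
    · intro i _ hi
      simp [taylorCoeff_id, hi]
    · simp
  rw [taylorCoeff_sub (hp.fun_sub (analyticAt_self.fun_mul hp.deriv)) analyticAt_const,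
    taylorCoeff_sub hp (analyticAt_self.fun_mul hp.deriv), hm, taylorCoeff_const]
  simp only [Nat.add_eq_zero_iff, one_ne_zero, and_false, if_false]
  ring

/-- The coefficients of `f` in terms of `a = a₂` and the coefficients `c₁, c₂, c₃` of the function
`ω` in `z / f z = 1 - a z - z ω z`, with the bounds for them. -/
theorem exists_coeff_of_mem_classU {f : ℂ → ℂ} (hf : f ∈ classU) :
    ∃ a c₁ c₂ c₃ : ℂ, taylorCoeff f 2 = a ∧ taylorCoeff f 3 = a ^ 2 + c₁ ∧
      taylorCoeff f 4 = a ^ 3 + 2 * a * c₁ + c₂ ∧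
      taylorCoeff f 5 = a ^ 4 + 3 * a ^ 2 * c₁ + c₁ ^ 2 + 2 * a * c₂ + c₃ ∧
      ‖c₁‖ + ‖c₂‖ ≤ 1 ∧ ‖c₁‖ + 3 / 2 * ‖c₃‖ ≤ 1 ∧ ‖a‖ ≤ 2 ∧ ‖a ^ 2 + c₁‖ ≤ 3 := by
  have h0 : Metric.ball (0 : ℂ) 1 ∈ 𝓝 0 := Metric.ball_mem_nhds 0 one_pos
  have hfa : AnalyticAt ℂ f 0 := hf.1.1 0 (Metric.mem_ball_self one_pos)
  obtain ⟨p, hpd, hp0, hpne, hfp, hpU⟩ := exists_div_of_mem_classU hf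
  have hpa : AnalyticAt ℂ p 0 := hpd.analyticAt h0
  have hF0 : taylorCoeff f 0 = 0 := by rw [taylorCoeff_zero, hf.1.2.1]
  have hF1 : taylorCoeff f 1 = 1 := by rw [taylorCoeff_one, hf.1.2.2]
  have hP0 : taylorCoeff p 0 = 1 := by rw [taylorCoeff_zero, hp0]
  have hrec := taylorCoeff_mul_eq_id hfa hpa (by filter_upwards [h0] with z hz using hfp z hz)
  have h2 := hrec 2
  have h3 := hrec 3
  have h4 := hrec 4
  have h5 := hrec 5
  simp only [Finset.sum_range_succ, Finset.sum_range_zero, hF0, hF1, hP0, Nat.reduceSub,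
    Nat.reduceEqDiff, if_false, zero_mul, zero_add, one_mul, mul_one] at h2 h3 h4 h5
  set u : ℂ → ℂ := fun z => p z - z * deriv p z - 1 with hu
  have hud : DifferentiableOn ℂ u (Metric.ball 0 1) :=
    (hpd.sub (differentiableOn_id.mul (hpd.deriv Metric.isOpen_ball))).sub_const 1
  have hu0 : taylorCoeff u 0 = 0 := by simp [taylorCoeff_zero, hu, hp0]
  have hu' := taylorCoeff_sub_mul_deriv hpa
  have hu1 : taylorCoeff u 1 = 0 := by simpa using hu' 0
  have hb := fun z hz => (hpU z hz).le
  -- `u` vanishes to second order at 0, so `m = 2` can be paired with both `n = 1` and `n = 2`.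
  have hB1 := norm_taylorCoeff_add_half_norm_le hud hb (m := 2) (n := 1) one_pos one_le_two hu1
  have hB2 := norm_taylorCoeff_add_half_norm_le hud hb (m := 2) (n := 2) two_pos le_rfl hu0
  have hn2 : ‖taylorCoeff u 2‖ = ‖taylorCoeff p 2‖ := by simpa using congrArg norm (hu' 1)
  have hn3 : ‖taylorCoeff u (2 + 1)‖ = 2 * ‖taylorCoeff p 3‖ := by
    simpa using congrArg norm (hu' 2)
  have hn4 : ‖taylorCoeff u (2 + 2)‖ = 3 * ‖taylorCoeff p 4‖ := by
    simpa using congrArg norm (hu' 3)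
  rw [hn2, hn3] at hB1
  rw [hn2, hn4] at hB2
  obtain ⟨w, hwd, hw0, hwb, hwp⟩ := exists_sq_one_add_eq hpd hpne hp0 hpU
  have hw0' : taylorCoeff w 0 = 0 := by rw [taylorCoeff_zero, hw0]
  have hB3 := norm_taylorCoeff_add_half_norm_le hwd hwb (m := 1) (n := 1) one_pos le_rfl hw0'
  have hq : AnalyticAt ℂ (fun z => 1 + w z) 0 := analyticAt_const.fun_add (hwd.analyticAt h0)
  have hq' : ∀ n, taylorCoeff (fun z => 1 + w z) (n + 1) = taylorCoeff w (n + 1) := fun n => by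
    have := taylorCoeff_sub hq (analyticAt_const (v := 1)) (n + 1)
    simpa [taylorCoeff_const] using this.symm
  have hsq : ∀ n, taylorCoeff p n = _ := fun n =>
    (taylorCoeff_congr (by filter_upwards [h0] with z hz using hwp z hz) n).trans
      (taylorCoeff_mul hq hq n)
  have hq0 : taylorCoeff (fun z => 1 + w z) 0 = 1 := by simp [taylorCoeff_zero, hw0]
  have hs1 := hsq 1
  have hs2 := hsq 2
  simp only [Finset.sum_range_succ, Finset.sum_range_zero, Nat.reduceSub, hq0, hq' 0, hq' 1,
    zero_add, one_mul, mul_one, Nat.reduceAdd] at hs1 hs2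
  have hB3' : ‖taylorCoeff w 1‖ + ‖taylorCoeff w 2‖ / 2 ≤ 1 := hB3
  set W₁ := taylorCoeff w 1
  set W₂ := taylorCoeff w 2
  have ha : taylorCoeff f 2 = -2 * W₁ := by linear_combination h2 - hs1
  have hnW1 : 0 ≤ ‖W₁‖ := norm_nonneg _
  have hnW2 : 0 ≤ ‖W₂‖ := norm_nonneg _
  have hna : ‖taylorCoeff f 2‖ = 2 * ‖W₁‖ := by rw [ha]; simp
  have hP2 : ‖-taylorCoeff p 2‖ ≤ 1 := by
    rw [norm_neg]
    linarith [norm_nonneg (taylorCoeff p 3)]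
  have e3 : taylorCoeff f 3 = taylorCoeff f 2 ^ 2 + -taylorCoeff p 2 := by
    linear_combination h3 - taylorCoeff f 2 * h2
  have e4 : taylorCoeff f 4 = taylorCoeff f 2 ^ 3 + 2 * taylorCoeff f 2 * -taylorCoeff p 2 +
      -taylorCoeff p 3 := by
    linear_combination h4 - taylorCoeff f 3 * h2 + taylorCoeff f 2 * e3
  refine ⟨taylorCoeff f 2, -taylorCoeff p 2, -taylorCoeff p 3, -taylorCoeff p 4, rfl,
    e3, e4, ?_, ?_, ?_, ?_, ?_⟩
  · linear_combination h5 - taylorCoeff f 4 * h2 + taylorCoeff f 2 * e4 - taylorCoeff p 2 * e3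
  · simpa only [norm_neg] using (by linarith : ‖taylorCoeff p 2‖ + ‖taylorCoeff p 3‖ ≤ 1)
  · simpa only [norm_neg] using (by linarith : ‖taylorCoeff p 2‖ + 3 / 2 * ‖taylorCoeff p 4‖ ≤ 1)
  · linarith
  -- For small `x = ‖W₁‖`, `|a₃| ≤ 4x² + 1 ≤ 3`. Otherwise `a₃ = 3 W₁² - 2 W₂` gives `|a₃| ≤ 3x² +
  -- 4(1 - x)`, which is at most 3 for `1/3 ≤ x ≤ 1`.
  · rcases le_total (‖W₁‖ ^ 2) (1 / 2) with h | h
    · have h1 := norm_add_le (taylorCoeff f 2 ^ 2) (-taylorCoeff p 2)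
      rw [norm_pow, hna] at h1
      nlinarith
    · have h1 : taylorCoeff f 2 ^ 2 + -taylorCoeff p 2 = 3 * W₁ ^ 2 - 2 * W₂ := by
        rw [ha, hs2]; ring
      have h2 := norm_sub_le (3 * W₁ ^ 2) (2 * W₂)
      rw [norm_mul, norm_mul, norm_pow] at h2
      rw [h1]
      norm_num at h2
      nlinarith

theorem norm_sub_le_of_mem_classU {f : ℂ → ℂ} (hf : f ∈ classU) :
    ‖taylorCoeff f 4 - taylorCoeff f 2 ^ 3‖ ≤ 4 ∧
      ‖taylorCoeff f 5 - taylorCoeff f 2 ^ 4‖ ≤ 11 := by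
  obtain ⟨a, c₁, c₂, c₃, h2, -, h4, h5, hc2, hc3, ha, ha3⟩ := exists_coeff_of_mem_classU hf
  have n1 := norm_nonneg c₁
  have n2 := norm_nonneg c₂
  have n3 := norm_nonneg c₃
  have na := norm_nonneg a
  have hc2' : ‖2 * a * c₂‖ ≤ 4 * ‖c₂‖ := by
    rw [norm_mul, norm_mul]
    norm_num
    nlinarith
  constructor
  · have e : taylorCoeff f 4 - taylorCoeff f 2 ^ 3 = 2 * a * c₁ + c₂ := by rw [h2, h4]; ring
    have hc1' : ‖2 * a * c₁‖ ≤ 4 * ‖c₁‖ := by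
      rw [norm_mul, norm_mul]
      norm_num
      nlinarith
    rw [e]
    linarith [norm_add_le (2 * a * c₁) c₂]
  · have e : taylorCoeff f 5 - taylorCoeff f 2 ^ 4 =
        c₁ * ((a ^ 2 + c₁) + 2 * a ^ 2) + 2 * a * c₂ + c₃ := by rw [h2, h5]; ring
    have h1 : ‖(a ^ 2 + c₁) + 2 * a ^ 2‖ ≤ 11 := by
      refine (norm_add_le _ _).trans ?_
      rw [norm_mul, norm_pow]
      norm_num
      nlinarith
    have h3 : ‖c₁ * ((a ^ 2 + c₁) + 2 * a ^ 2)‖ ≤ 11 * ‖c₁‖ := by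
      rw [norm_mul, mul_comm]
      exact mul_le_mul_of_nonneg_right h1 n1
    rw [e]
    -- `11|c₁| + 4|c₂| + |c₃| = 4(|c₁| + |c₂|) + (7|c₁| + |c₃|) ≤ 4 + 7`.
    linarith [norm_add₃_le (a := c₁ * ((a ^ 2 + c₁) + 2 * a ^ 2)) (b := 2 * a * c₂) (c := c₃)]

/-! ### Sharpness: the Koebe function and its rotations. -/

theorem rotateFun_koebe_apply (θ : ℝ) (z : ℂ) :
    rotateFun θ koebe z = z / (1 - Complex.exp (θ * Complex.I) * z) ^ 2 := by
  have := Complex.exp_ne_zero (θ * Complex.I)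
  rw [rotateFun, koebe, Complex.exp_neg]
  field_simp

theorem rotateFun_zero (f : ℂ → ℂ) : rotateFun 0 f = f := by
  ext z; simp [rotateFun]

theorem one_sub_mul_ne_zero {c z : ℂ} (hc : ‖c‖ = 1) (hz : z ∈ Metric.ball (0 : ℂ) 1) :
    1 - c * z ≠ 0 := fun h => by
  have h1 : ‖c * z‖ = 1 := by rw [← sub_eq_zero.mp h, norm_one]
  rw [norm_mul, hc, one_mul] at h1
  simp [h1] at hz

theorem rotateFun_koebe_mem_classU (θ : ℝ) : rotateFun θ koebe ∈ classU := by
  have hc : ‖Complex.exp (θ * Complex.I)‖ = 1 := Complex.norm_exp_ofReal_mul_I θ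
  have hf : rotateFun θ koebe = fun z => z / (1 - Complex.exp (θ * Complex.I) * z) ^ 2 :=
    funext (rotateFun_koebe_apply θ)
  rw [hf]
  set c := Complex.exp (θ * Complex.I)
  have hd : ∀ z ∈ Metric.ball (0 : ℂ) 1, HasDerivAt (fun z => z / (1 - c * z) ^ 2)
      ((1 + c * z) / (1 - c * z) ^ 3) z := fun z hz => by
    have hne := one_sub_mul_ne_zero hc hz
    have h1 : HasDerivAt (fun z => 1 - c * z) (-c) z := by
      simpa using ((hasDerivAt_id z).const_mul c).const_sub 1
    refine ((hasDerivAt_id' z).fun_div (h1.fun_pow 2) (pow_ne_zero 2 hne)).congr_deriv ?_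
    rw [div_eq_div_iff (pow_ne_zero 2 (pow_ne_zero 2 hne)) (pow_ne_zero 3 hne)]
    push_cast
    ring
  refine ⟨⟨?_, by simp, ?_⟩, fun z hz hz0 => ?_⟩
  · exact DifferentiableOn.analyticOnNhd
      (fun z hz => (hd z hz).differentiableAt.differentiableWithinAt) Metric.isOpen_ball
  · rw [(hd 0 (Metric.mem_ball_self one_pos)).deriv]
    simp
  · have hne := one_sub_mul_ne_zero hc hz
    refine ⟨div_ne_zero hz0 (pow_ne_zero 2 hne), ?_⟩
    -- Here `p = (1 - c z)²`, so `p - z p' - 1 = -(c z)²`, of modulus `|z|² < 1`.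
    have e : (z / (z / (1 - c * z) ^ 2)) ^ 2 * ((1 + c * z) / (1 - c * z) ^ 3) - 1
        = -(c * z) ^ 2 := by
      field_simp
      ring
    rw [(hd z hz).deriv, e, norm_neg, norm_pow, norm_mul, hc, one_mul]
    exact pow_lt_one₀ (norm_nonneg z) (by simpa using hz) two_ne_zero

theorem taylorCoeff_rotateFun_koebe (θ : ℝ) :
    taylorCoeff (rotateFun θ koebe) 2 = 2 * Complex.exp (θ * Complex.I) ∧
      taylorCoeff (rotateFun θ koebe) 4 = 4 * Complex.exp (θ * Complex.I) ^ 3 ∧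
      taylorCoeff (rotateFun θ koebe) 5 = 5 * Complex.exp (θ * Complex.I) ^ 4 := by
  have hc : ‖Complex.exp (θ * Complex.I)‖ = 1 := Complex.norm_exp_ofReal_mul_I θ
  have hU := rotateFun_koebe_mem_classU θ
  have hf := rotateFun_koebe_apply θ
  set c := Complex.exp (θ * Complex.I)
  set f := rotateFun θ koebe
  have hfa : AnalyticAt ℂ f 0 := hU.1.1 0 (Metric.mem_ball_self one_pos)
  have hla : AnalyticAt ℂ (fun z : ℂ => c * z) 0 := analyticAt_const.fun_mul analyticAt_self
  have hqa : AnalyticAt ℂ (fun z => 1 - c * z) 0 := analyticAt_const.fun_sub hla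
  have hq : ∀ n, taylorCoeff (fun z => 1 - c * z) n =
      (if n = 0 then 1 else 0) - if n = 1 then c else 0 := fun n => by
    have hl : taylorCoeff (fun z : ℂ => c * z) n = if n = 1 then c else 0 := by
      rw [taylorCoeff_mul analyticAt_const analyticAt_self, Finset.sum_eq_single 0]
      · simp [taylorCoeff_const, taylorCoeff_id]
      · intro i _ hi
        simp [taylorCoeff_const, hi]
      · simp
    rw [taylorCoeff_sub analyticAt_const hla, taylorCoeff_const, hl]
  -- Comparing coefficients in `f (1 - c z)² = z` gives a linear recursion for those of `f`.
  have hrec := taylorCoeff_mul_eq_id hfa (hqa.fun_mul hqa) (by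
    filter_upwards [Metric.ball_mem_nhds (0 : ℂ) one_pos] with z hz
    have := one_sub_mul_ne_zero hc hz
    rw [hf, sq, div_mul_cancel₀ _ (mul_ne_zero this this)])
  have hF0 : taylorCoeff f 0 = 0 := by rw [taylorCoeff_zero, hU.1.2.1]
  have hF1 : taylorCoeff f 1 = 1 := by rw [taylorCoeff_one, hU.1.2.2]
  have h2 := hrec 2
  have h3 := hrec 3
  have h4 := hrec 4
  have h5 := hrec 5
  simp [Finset.sum_range_succ, taylorCoeff_mul hqa hqa, hF0, hF1, hq] at h2 h3 h4 h5
  have e2 : taylorCoeff f 2 = 2 * c := by linear_combination h2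
  have e3 : taylorCoeff f 3 = 3 * c ^ 2 := by linear_combination h3 + 2 * c * e2
  have e4 : taylorCoeff f 4 = 4 * c ^ 3 := by linear_combination h4 + 2 * c * e3 - c ^ 2 * e2
  exact ⟨e2, e4, by linear_combination h5 + 2 * c * e4 - c ^ 2 * e3⟩

theorem rotateFun_koebe_equality (θ : ℝ) :
    ‖taylorCoeff (rotateFun θ koebe) 4 - taylorCoeff (rotateFun θ koebe) 2 ^ 3‖ = 4 ∧
      ‖taylorCoeff (rotateFun θ koebe) 5 - taylorCoeff (rotateFun θ koebe) 2 ^ 4‖ = 11 := by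
  have hc : ‖Complex.exp (θ * Complex.I)‖ = 1 := Complex.norm_exp_ofReal_mul_I θ
  obtain ⟨h2, h4, h5⟩ := taylorCoeff_rotateFun_koebe θ
  rw [h2, h4, h5]
  set c := Complex.exp (θ * Complex.I)
  constructor
  · rw [show 4 * c ^ 3 - (2 * c) ^ 3 = -4 * c ^ 3 by ring, norm_mul, norm_pow, hc]
    norm_num
  · rw [show 5 * c ^ 4 - (2 * c) ^ 4 = -11 * c ^ 4 by ring, norm_mul, norm_pow, hc]
    norm_num

theorem mainTheorem3 :
    (∀ f ∈ classU,
      ‖taylorCoeff f 4 - taylorCoeff f 2 ^ 3‖ ≤ 4 ∧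
      ‖taylorCoeff f 5 - taylorCoeff f 2 ^ 4‖ ≤ 11 ∧
      KrushkalInequality f 4 1 ∧ KrushkalInequality f 5 1) ∧
    (koebe ∈ classU ∧
      ‖taylorCoeff koebe 4 - taylorCoeff koebe 2 ^ 3‖ = 4 ∧
      ‖taylorCoeff koebe 5 - taylorCoeff koebe 2 ^ 4‖ = 11) ∧
    (∀ θ : ℝ, rotateFun θ koebe ∈ classU ∧
      ‖taylorCoeff (rotateFun θ koebe) 4 - taylorCoeff (rotateFun θ koebe) 2 ^ 3‖ = 4 ∧
      ‖taylorCoeff (rotateFun θ koebe) 5 - taylorCoeff (rotateFun θ koebe) 2 ^ 4‖ = 11) := by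
  have hrot := fun θ : ℝ =>
    And.intro (rotateFun_koebe_mem_classU θ) (rotateFun_koebe_equality θ)
  refine ⟨fun f hf => ?_, by simpa only [rotateFun_zero] using hrot 0, hrot⟩
  obtain ⟨h4, h5⟩ := norm_sub_le_of_mem_classU hf
  refine ⟨h4, h5, ?_, ?_⟩
  · rw [KrushkalInequality]
    norm_num
    exact h4
  · rw [KrushkalInequality]
    norm_num
    exact h5
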